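/- Let $N\in\mathbb N$ and $1<p<N$. For $\delta>0$ and a measurable function $w:\mathbb R^N\to\mathbb R$ put $$I_\delta(w)=\iint_{\{|w(y)-w(x)|>\delta\}}\frac{\delta^p}{|x-y|^{N+p}}\,dx\,dy\in[0,\infty].$$ For a nonnegative $u\in L^p(\mathbb R^N)$ let $u^*$ denote its Schwarz symmetric rearrangement, $$u^*(x)=\sup\{t\ge 0:\ |\{u>t\}|>|B(0,|x|)|\},\qquad \sup\emptyset=0,$$ which is finite for every $x\neq 0$ (the value at the single point $x=0$ is immaterial). Let $(u_n)_{n\in\mathbb N}$ be a sequence of nonnegative functions that is bounded in $L^p(\mathbb R^N)$, and suppose that $$\liminf_{n\to\infty} I_{\delta_n}(u_n^*)<\infty$$ for some sequence $(\delta_n)$ with $\delta_n\to 0_+$. Then there are a subsequence $(u_{n_k})$ and a radially symmetric, radially decreasing (i.e. nonincreasing in $|x|$ on $\mathbb R^N\setminus\{0\}$) function $v:\mathbb R^N\to\mathbb R$ such that, for every $r$ with $p<r<\frac{Np}{N-p}$, the functions $u_{n_k}^*$ and $v$ belong to $L^r(\mathbb R^N)$ and $u_{n_k}^*\to v$ strongly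 in $L^r(\mathbb R^N)$ as $k\to\infty$. -/

import Mathlib

open MeasureTheory Filter Topology
open scoped ENNReal NNReal

noncomputable section

/-- The functional
`I_δ(u) = ∬_{|u(y) - u(x)| > δ} δ^p / |x - y|^(N + p) dx dy`, with values in `[0, ∞]`. -/
def nonlocalEnergy {N : ℕ} (p δ : ℝ) (u : EuclideanSpace ℝ (Fin N) → ℝ) : ℝ≥0∞ :=
  ∫⁻ z in {z : EuclideanSpace ℝ (Fin N) × EuclideanSpace ℝ (Fin N) | δ < |u z.2 - u z.1|},
    ENNReal.ofReal (δ ^ p / ‖z.1 - z.2‖ ^ ((N : ℝ) + p))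

/-- The distribution function `μ_u(t) = |{x : |u(x)| > t}|`. -/
def distributionFunction {N : ℕ} (u : EuclideanSpace ℝ (Fin N) → ℝ) (t : ℝ) : ℝ≥0∞ :=
  volume {x : EuclideanSpace ℝ (Fin N) | t < |u x|}

/-- The Schwarz symmetric rearrangement
`u^*(x) = sup {t ≥ 0 : μ_u(t) > |B(0, |x|)|}`, where the supremum of the empty set is `0`.
If `μ_u(t) → 0` as `t → ∞` (for instance if `u ∈ L^p`), the supremum is finite at every `x ≠ 0`;
if it is infinite at the single point `x = 0`, the real number stored there is `0`. -/
def schwarzRearrangement {N : ℕ} (u : EuclideanSpace ℝ (Fin N) → ℝ)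
    (x : EuclideanSpace ℝ (Fin N)) : ℝ :=
  sSup {t : ℝ | 0 ≤ t ∧
    volume (Metric.ball (0 : EuclideanSpace ℝ (Fin N)) ‖x‖) < distributionFunction u t}

/-- `v` is a radially symmetric decreasing (that is, nonincreasing) function. Taking `‖x‖ = ‖y‖`
shows that `v` is radial. The value at the origin is left free, since a radially
decreasing function may be unbounded near the origin. -/
def IsRadiallyDecreasing {N : ℕ} (v : EuclideanSpace ℝ (Fin N) → ℝ) : Prop :=
  ∀ x y : EuclideanSpace ℝ (Fin N), x ≠ 0 → ‖x‖ ≤ ‖y‖ → v y ≤ v x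

end

/-! A power envelope independent of n dominates the rearrangements along a subsequence; monotonicity
supplies pointwise compactness (Helly), and dominated convergence does the rest. At infinity,
Chebyshev and the `L^p` bound give decay `|x|^(-N/p)`. Near the origin the energy gives growth at
most `|x|^(-(N-p)/p)`. The two exponents are exactly those for which the envelope lies in `L^r` for
all `p < r < Np/(N-p)`. For the growth bound, cut `R/2 ≤ |x| ≤ R` along level spheres into `m`
shells, across each of which the profile drops by `δ`. A shell of inner radius `τ` and width `d`
costs energy at least `c δ^p τ^(N-1) d^(1-p)` (`le_lintegral_shellPairs`). Since `d^(1-p)` is convex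
and decreasing, equal widths are cheapest, so the total is at least `c (mδ)^p (R/2)^(N-p)`. This
bounds the drop `mδ` up to an error `δ` (`radialProfile_half_le`), and the dyadic drops are then
added up. -/

/-! ### Energy of spherical shells -/

/-- Pairs of points lying on the two sides of the spherical shell `τ ≤ ‖x‖ ≤ σ`, at distance
comparable to its width. -/
def shellPairs (N : ℕ) (τ σ : ℝ) :
    Set (EuclideanSpace ℝ (Fin N) × EuclideanSpace ℝ (Fin N)) :=
  {z | τ - (σ - τ) / 2 < ‖z.1‖ ∧ ‖z.1‖ < τ ∧ σ < ‖z.2‖ ∧ ‖z.2‖ < σ + (σ - τ) / 2 ∧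
    ‖z.1 - z.2‖ < 2 * (σ - τ)}

theorem isOpen_shellPairs (N : ℕ) (τ σ : ℝ) : IsOpen (shellPairs N τ σ) := by
  have h1 : Continuous fun z : EuclideanSpace ℝ (Fin N) × EuclideanSpace ℝ (Fin N) => ‖z.1‖ := by
    fun_prop
  have h2 : Continuous fun z : EuclideanSpace ℝ (Fin N) × EuclideanSpace ℝ (Fin N) => ‖z.2‖ := by
    fun_prop
  have h3 : Continuous fun z : EuclideanSpace ℝ (Fin N) × EuclideanSpace ℝ (Fin N) =>
    ‖z.1 - z.2‖ := by fun_prop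
  exact (isOpen_lt continuous_const h1).inter ((isOpen_lt h1 continuous_const).inter
    ((isOpen_lt continuous_const h2).inter ((isOpen_lt h2 continuous_const).inter
    (isOpen_lt h3 continuous_const))))

/-- The half-width collars may overlap the neighbouring shell, but with widths `d₁`, `d₂` a common
pair would force both `d₁ > 2 d₂` and `d₂ > 2 d₁`. -/
theorem disjoint_shellPairs {N : ℕ} {τ₁ σ₁ τ₂ σ₂ : ℝ} (h : σ₂ ≤ τ₁) :
    Disjoint (shellPairs N τ₁ σ₁) (shellPairs N τ₂ σ₂) := by
  rw [Set.disjoint_left]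
  rintro z ⟨h1, h2, h3, h4, -⟩ ⟨k1, k2, k3, k4, -⟩
  linarith

theorem volume_ball_eq {N : ℕ} (hN : N ≠ 0) (x : EuclideanSpace ℝ (Fin N)) {r : ℝ} (hr : 0 ≤ r) :
    volume (Metric.ball x r) =
      ENNReal.ofReal (r ^ N * volume.real (Metric.ball (0 : EuclideanSpace ℝ (Fin N)) 1)) := by
  have : Nonempty (Fin N) := ⟨⟨0, Nat.pos_of_ne_zero hN⟩⟩
  rw [Measure.addHaar_ball _ _ hr, finrank_euclideanSpace_fin, ENNReal.ofReal_mul (by positivity),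
    ofReal_measureReal]

theorem volume_real_unitBall_pos (N : ℕ) :
    0 < volume.real (Metric.ball (0 : EuclideanSpace ℝ (Fin N)) 1) :=
  ENNReal.toReal_pos (Metric.measure_ball_pos _ _ one_pos).ne' measure_ball_lt_top.ne

theorem pow_pred_mul_sub_le {N : ℕ} (hN : N ≠ 0) {a b : ℝ} (hb : 0 ≤ b) (hab : b ≤ a) :
    a ^ (N - 1) * (a - b) ≤ a ^ N - b ^ N := by
  obtain ⟨n, rfl⟩ := Nat.exists_eq_succ_of_ne_zero hN
  have : b ^ n ≤ a ^ n := pow_le_pow_left₀ hb hab n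
  simp only [Nat.succ_eq_add_one, Nat.add_sub_cancel, pow_succ]
  nlinarith

theorem le_volume_shell {N : ℕ} (hN : N ≠ 0) {a b : ℝ} (hb : 0 ≤ b) (hab : b ≤ a) :
    ENNReal.ofReal (a ^ (N - 1) * (a - b) *
        volume.real (Metric.ball (0 : EuclideanSpace ℝ (Fin N)) 1)) ≤
      volume (Metric.ball (0 : EuclideanSpace ℝ (Fin N)) a \ Metric.closedBall 0 b) := by
  have : Nonempty (Fin N) := ⟨⟨0, Nat.pos_of_ne_zero hN⟩⟩
  refine le_trans ?_ le_measure_sdiff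
  rw [Measure.addHaar_closedBall_eq_addHaar_ball, volume_ball_eq hN _ hb,
    volume_ball_eq hN _ (hb.trans hab), ← ENNReal.ofReal_sub _ (by positivity), ← sub_mul]
  exact ENNReal.ofReal_le_ofReal
    (mul_le_mul_of_nonneg_right (pow_pred_mul_sub_le hN hb hab) measureReal_nonneg)

/-- Fubini, with `d = σ - τ`: for each `x` in the inner collar, the slice contains the ball of
radius `d/4` about the point at radius `σ + d/4` on the ray through `x`. That point is within `7d/4`
of `x`, whence the cutoff `2d` in `shellPairs`. -/
theorem le_volume_shellPairs {N : ℕ} (hN : N ≠ 0) {τ σ : ℝ} (hτσ : τ < σ)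
    (hd : (σ - τ) / 2 ≤ τ) :
    ENNReal.ofReal (τ ^ (N - 1) * ((σ - τ) / 2) * ((σ - τ) / 4) ^ N *
        volume.real (Metric.ball (0 : EuclideanSpace ℝ (Fin N)) 1) ^ 2) ≤
      volume (shellPairs N τ σ) := by
  set ω := volume.real (Metric.ball (0 : EuclideanSpace ℝ (Fin N)) 1) with hω
  have hω0 : 0 < ω := volume_real_unitBall_pos N
  have hd0 : 0 < σ - τ := sub_pos.2 hτσ
  set A := Metric.ball (0 : EuclideanSpace ℝ (Fin N)) τ \ Metric.closedBall 0 (τ - (σ - τ) / 2)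
  have hA : MeasurableSet A := measurableSet_ball.diff measurableSet_closedBall
  rw [Measure.volume_eq_prod, Measure.prod_apply (isOpen_shellPairs N τ σ).measurableSet]
  calc ENNReal.ofReal (τ ^ (N - 1) * ((σ - τ) / 2) * ((σ - τ) / 4) ^ N * ω ^ 2)
      = ENNReal.ofReal (((σ - τ) / 4) ^ N * ω) *
          ENNReal.ofReal (τ ^ (N - 1) * (τ - (τ - (σ - τ) / 2)) * ω) := by
        rw [← ENNReal.ofReal_mul (by positivity)]; congr 1; ring
    _ ≤ ENNReal.ofReal (((σ - τ) / 4) ^ N * ω) * volume A := by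
        gcongr
        exact le_volume_shell hN (by linarith) (by linarith)
    _ = ∫⁻ _ in A, ENNReal.ofReal (((σ - τ) / 4) ^ N * ω) := by rw [setLIntegral_const]
    _ ≤ ∫⁻ x in A, volume (Prod.mk x ⁻¹' shellPairs N τ σ) := by
        refine setLIntegral_mono' hA fun x hx => ?_
        have hx1 : ‖x‖ < τ := by simpa using hx.1
        have hx2 : τ - (σ - τ) / 2 < ‖x‖ := by simpa using hx.2
        have hx0 : 0 < ‖x‖ := by linarith
        set q : ℝ := σ + (σ - τ) / 4 with hq
        have hq0 : 0 < q := by linarith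
        set z : EuclideanSpace ℝ (Fin N) := (q / ‖x‖) • x with hz
        have hzn : ‖z‖ = q := by
          rw [hz, norm_smul, Real.norm_of_nonneg (by positivity)]; field_simp
        have hxz : ‖x - z‖ = q - ‖x‖ := by
          have : x - z = (1 - q / ‖x‖) • x := by rw [hz, sub_smul, one_smul]
          rw [this, norm_smul, Real.norm_eq_abs, abs_of_nonpos]
          · field_simp; ring
          · rw [sub_nonpos, le_div_iff₀ hx0]; linarith
        rw [← volume_ball_eq hN z (by positivity)]
        refine measure_mono fun y hy => ?_
        rw [Metric.mem_ball, dist_eq_norm] at hy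
        have h1 := abs_lt.1 ((abs_norm_sub_norm_le y z).trans_lt hy)
        have h2 : ‖x - y‖ ≤ ‖x - z‖ + ‖y - z‖ := by
          rw [norm_sub_rev y z]; exact norm_sub_le_norm_sub_add_norm_sub x z y
        refine ⟨hx2, hx1, ?_, ?_, ?_⟩ <;> simp only <;> linarith
    _ ≤ ∫⁻ x, volume (Prod.mk x ⁻¹' shellPairs N τ σ) := setLIntegral_le_lintegral _ _

/-- The constant in the lower bound for the energy carried by one shell. -/
noncomputable def shellConst (N : ℕ) (p : ℝ) : ℝ :=
  volume.real (Metric.ball (0 : EuclideanSpace ℝ (Fin N)) 1) ^ 2 /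
    (2 * 4 ^ N * 2 ^ ((N : ℝ) + p))

theorem shellConst_pos (N : ℕ) (p : ℝ) : 0 < shellConst N p := by
  have := volume_real_unitBall_pos N
  unfold shellConst
  positivity

/-- The kernel is at least `δ^p / (2d)^(N+p)` on a set of measure of order at least `τ^(N-1)
d^(N+1)`. The resulting power `d^(1-p)` is negative, so thin shells are expensive. -/
theorem le_lintegral_shellPairs {N : ℕ} (hN : N ≠ 0) {p δ τ σ : ℝ} (hp : 0 < p) (hδ : 0 < δ)
    (hτσ : τ < σ) (hd : (σ - τ) / 2 ≤ τ) :
    ENNReal.ofReal (shellConst N p * δ ^ p * (τ ^ (N - 1) * (σ - τ) ^ (1 - p))) ≤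
      ∫⁻ z in shellPairs N τ σ, ENNReal.ofReal (δ ^ p / ‖z.1 - z.2‖ ^ ((N : ℝ) + p)) := by
  have hd0 : 0 < σ - τ := sub_pos.2 hτσ
  have hτ : 0 < τ := by linarith
  have hω0 := volume_real_unitBall_pos N
  calc _ = ENNReal.ofReal (δ ^ p / (2 * (σ - τ)) ^ ((N : ℝ) + p)) *
        ENNReal.ofReal (τ ^ (N - 1) * ((σ - τ) / 2) * ((σ - τ) / 4) ^ N *
          volume.real (Metric.ball (0 : EuclideanSpace ℝ (Fin N)) 1) ^ 2) := by
        rw [← ENNReal.ofReal_mul (by positivity)]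
        congr 1
        rw [shellConst, Real.mul_rpow (by norm_num) hd0.le, Real.rpow_add hd0, Real.rpow_sub hd0,
          Real.rpow_natCast, Real.rpow_one, div_pow]
        field_simp
    _ ≤ ENNReal.ofReal (δ ^ p / (2 * (σ - τ)) ^ ((N : ℝ) + p)) * volume (shellPairs N τ σ) := by
        gcongr
        exact le_volume_shellPairs hN hτσ hd
    _ = ∫⁻ _ in shellPairs N τ σ, ENNReal.ofReal (δ ^ p / (2 * (σ - τ)) ^ ((N : ℝ) + p)) := by
        rw [setLIntegral_const]
    _ ≤ _ := by
        refine setLIntegral_mono' (isOpen_shellPairs N τ σ).measurableSet fun z hz => ?_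
        obtain ⟨h1, h2, h3, h4, h5⟩ := hz
        have : 0 < ‖z.1 - z.2‖ := by
          rw [norm_pos_iff, sub_ne_zero]
          intro h
          rw [h] at h2
          linarith
        gcongr

/-- Energy carried by finitely many non-overlapping shells across each of which a function drops
by more than `δ`. -/
theorem sum_shells_le_nonlocalEnergy {N : ℕ} (hN : N ≠ 0) {p δ : ℝ} (hp : 0 < p) (hδ : 0 < δ)
    {f : EuclideanSpace ℝ (Fin N) → ℝ} {ι : Type*} [LinearOrder ι] (s : Finset ι) (τ σ : ι → ℝ)
    (hτσ : ∀ i ∈ s, τ i < σ i) (hd : ∀ i ∈ s, (σ i - τ i) / 2 ≤ τ i)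
    (hdisj : ∀ i ∈ s, ∀ j ∈ s, i < j → σ j ≤ τ i)
    (hjump : ∀ i ∈ s, ∀ x y, x ≠ 0 → ‖x‖ < τ i → σ i < ‖y‖ → f y + δ < f x) :
    ENNReal.ofReal (shellConst N p * δ ^ p *
        ∑ i ∈ s, τ i ^ (N - 1) * (σ i - τ i) ^ (1 - p)) ≤ nonlocalEnergy p δ f := by
  have hτ : ∀ i ∈ s, 0 < τ i := fun i hi => by linarith [hτσ i hi, hd i hi]
  have hc := shellConst_pos N p
  have hdis : Set.PairwiseDisjoint (s : Set ι) fun i => shellPairs N (τ i) (σ i) := by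
    intro i hi j hj hij
    rcases lt_or_gt_of_ne hij with h | h
    · exact disjoint_shellPairs (hdisj i hi j hj h)
    · exact (disjoint_shellPairs (hdisj j hj i hi h)).symm
  rw [Finset.mul_sum, ENNReal.ofReal_sum_of_nonneg]
  · calc _ ≤ ∑ i ∈ s, ∫⁻ z in shellPairs N (τ i) (σ i),
          ENNReal.ofReal (δ ^ p / ‖z.1 - z.2‖ ^ ((N : ℝ) + p)) :=
        Finset.sum_le_sum fun i hi => le_lintegral_shellPairs hN hp hδ (hτσ i hi) (hd i hi)
      _ = ∫⁻ z in ⋃ i ∈ s, shellPairs N (τ i) (σ i),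
          ENNReal.ofReal (δ ^ p / ‖z.1 - z.2‖ ^ ((N : ℝ) + p)) :=
        (lintegral_biUnion_finset hdis (fun i _ => (isOpen_shellPairs N _ _).measurableSet) _).symm
      _ ≤ _ := by
        refine lintegral_mono_set (Set.iUnion₂_subset fun i hi z hz => ?_)
        obtain ⟨h1, h2, h3, h4, h5⟩ := hz
        have h6 := hd i hi
        have := hjump i hi z.1 z.2 (norm_pos_iff.1 (by linarith)) h2 h3
        rw [Set.mem_ofPred_eq, abs_sub_comm, lt_abs]
        left
        linarith
  · intro i hi
    have := hτ i hi
    have := sub_pos.2 (hτσ i hi)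
    positivity

/-- Jensen for the convex function `x^(1-p)`, by its tangent line at the mean `l / card`. As the
function decreases, `∑ d ≤ l` suffices in place of equality. -/
theorem mul_div_rpow_le_sum_rpow {ι : Type*} (s : Finset ι) (d : ι → ℝ) {p l : ℝ} (hp : 1 < p)
    (hd : ∀ i ∈ s, 0 < d i) (hs : s.Nonempty) (hl : 0 < l) (hsum : ∑ i ∈ s, d i ≤ l) :
    (s.card : ℝ) * (l / s.card) ^ (1 - p) ≤ ∑ i ∈ s, d i ^ (1 - p) := by
  have hm : (0 : ℝ) < s.card := by exact_mod_cast hs.card_pos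
  set a : ℝ := l / s.card with ha
  have ha0 : 0 < a := by positivity
  have key : ∀ i ∈ s, a ^ (1 - p) * (1 + (1 - p) * (d i / a - 1)) ≤ d i ^ (1 - p) := by
    intro i hi
    have hx : 0 < d i / a := div_pos (hd i hi) ha0
    have h1 : d i ^ (1 - p) = a ^ (1 - p) * (d i / a) ^ (1 - p) := by
      rw [← Real.mul_rpow ha0.le hx.le]; field_simp
    rw [h1]
    refine mul_le_mul_of_nonneg_left ?_ (by positivity)
    rw [Real.rpow_def_of_pos hx]
    have h2 := Real.add_one_le_exp (Real.log (d i / a) * (1 - p))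
    have h3 := Real.log_le_sub_one_of_pos hx
    nlinarith
  calc (s.card : ℝ) * a ^ (1 - p)
      ≤ ∑ i ∈ s, a ^ (1 - p) * (1 + (1 - p) * (d i / a - 1)) := by
        rw [← Finset.mul_sum, Finset.sum_add_distrib, ← Finset.mul_sum, Finset.sum_sub_distrib,
          ← Finset.sum_div]
        simp only [Finset.sum_const, nsmul_eq_mul, mul_one]
        have : (∑ i ∈ s, d i) / a ≤ s.card := by
          rw [div_le_iff₀ ha0, ha]; field_simp; exact hsum
        rw [mul_comm]
        refine mul_le_mul_of_nonneg_left ?_ (by positivity)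
        nlinarith
    _ ≤ _ := Finset.sum_le_sum key

/-! ### Radial profiles and level radii -/

theorem EuclideanSpace.exists_norm_eq {N : ℕ} (hN : N ≠ 0) {r : ℝ} (hr : 0 ≤ r) :
    ∃ x : EuclideanSpace ℝ (Fin N), ‖x‖ = r := by
  have : Nonempty (Fin N) := ⟨⟨0, Nat.pos_of_ne_zero hN⟩⟩
  have : Nontrivial (EuclideanSpace ℝ (Fin N)) := inferInstance
  obtain ⟨x, hx⟩ := NormedSpace.sphere_nonempty (x := (0 : EuclideanSpace ℝ (Fin N))).2 hr
  exact ⟨x, by simpa using hx⟩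

/-- The radial profile of a function on `ℝ^N`, evaluated along a fixed ray. -/
noncomputable def radialProfile {N : ℕ} (f : EuclideanSpace ℝ (Fin N) → ℝ) (r : ℝ) : ℝ :=
  if h : N ≠ 0 ∧ 0 ≤ r then f (EuclideanSpace.exists_norm_eq h.1 h.2).choose else 0

theorem IsRadiallyDecreasing.eq_radialProfile {N : ℕ} (hN : N ≠ 0)
    {f : EuclideanSpace ℝ (Fin N) → ℝ} (hf : IsRadiallyDecreasing f)
    {x : EuclideanSpace ℝ (Fin N)} (hx : x ≠ 0) : f x = radialProfile f ‖x‖ := by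
  have h : N ≠ 0 ∧ 0 ≤ ‖x‖ := ⟨hN, norm_nonneg x⟩
  rw [radialProfile, dif_pos h]
  have hy := (EuclideanSpace.exists_norm_eq h.1 h.2).choose_spec
  exact le_antisymm (hf _ _ (norm_pos_iff.1 (by rw [hy]; exact norm_pos_iff.2 hx)) hy.le)
    (hf _ _ hx hy.ge)

theorem IsRadiallyDecreasing.antitoneOn_radialProfile {N : ℕ} (hN : N ≠ 0)
    {f : EuclideanSpace ℝ (Fin N) → ℝ} (hf : IsRadiallyDecreasing f) :
    AntitoneOn (radialProfile f) (Set.Ioi 0) := by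
  intro r hr s hs hrs
  obtain ⟨x, rfl⟩ := EuclideanSpace.exists_norm_eq hN (le_of_lt hr)
  obtain ⟨y, rfl⟩ := EuclideanSpace.exists_norm_eq hN (le_of_lt hs)
  rw [← hf.eq_radialProfile hN (norm_pos_iff.1 hr), ← hf.eq_radialProfile hN (norm_pos_iff.1 hs)]
  exact hf _ _ (norm_pos_iff.1 hr) hrs

/-- Superlevel sets of the profile on the open half-line are intervals; the origin, where the value
is free, adds at most one point. -/
theorem IsRadiallyDecreasing.measurable {N : ℕ} (hN : N ≠ 0)
    {f : EuclideanSpace ℝ (Fin N) → ℝ} (hf : IsRadiallyDecreasing f) : Measurable f := by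
  refine measurable_of_Ioi fun t => ?_
  have hS : MeasurableSet {r : ℝ | 0 < r ∧ t < radialProfile f r} := by
    refine Set.OrdConnected.measurableSet ⟨fun a ha b hb c hc => ?_⟩
    have hc0 : 0 < c := ha.1.trans_le hc.1
    exact ⟨hc0, hb.2.trans_le (hf.antitoneOn_radialProfile hN hc0 hb.1 hc.2)⟩
  have h0 : (f ⁻¹' Set.Ioi t ∩ {0}).Subsingleton :=
    Set.subsingleton_singleton.anti Set.inter_subset_right
  have : f ⁻¹' Set.Ioi t =
      (fun x => ‖x‖) ⁻¹' {r : ℝ | 0 < r ∧ t < radialProfile f r} ∪ (f ⁻¹' Set.Ioi t ∩ {0}) := by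
    ext x
    rcases eq_or_ne x 0 with rfl | hx
    · simp
    · simp [hx, hf.eq_radialProfile hN hx]
  rw [this]
  exact (measurable_norm hS).union h0.measurableSet

/-- The radius of the superlevel set `{t < g}` of a profile. -/
noncomputable def levelRadius (g : ℝ → ℝ) (t : ℝ) : ℝ := sSup {r | 0 < r ∧ t < g r}

section LevelRadius

variable {g : ℝ → ℝ} {a b t : ℝ}

theorem levelRadius_mem (hg : AntitoneOn g (Set.Ioi 0)) (ha : 0 < a) (hb : 0 < b)
    (hta : t < g a) (htb : g b ≤ t) : BddAbove {r | 0 < r ∧ t < g r} ∧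
      a ≤ levelRadius g t ∧ levelRadius g t ≤ b := by
  have hbd : ∀ r ∈ {r | 0 < r ∧ t < g r}, r ≤ b := by
    rintro r ⟨hr, htr⟩
    by_contra! h
    exact absurd (htr.trans_le (hg hb hr h.le)) (not_lt.2 htb)
  have hB : BddAbove {r | 0 < r ∧ t < g r} := ⟨b, hbd⟩
  have hmem : a ∈ {r | 0 < r ∧ t < g r} := ⟨ha, hta⟩
  exact ⟨hB, le_csSup hB hmem, csSup_le ⟨a, hmem⟩ hbd⟩

theorem lt_of_lt_levelRadius (hg : AntitoneOn g (Set.Ioi 0)) (ha : 0 < a) (hta : t < g a)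
    {r : ℝ} (hr : 0 < r) (h : r < levelRadius g t) : t < g r := by
  have hne : {r | 0 < r ∧ t < g r}.Nonempty := ⟨a, ha, hta⟩
  obtain ⟨s, ⟨hs, hts⟩, hrs⟩ := exists_lt_of_lt_csSup hne h
  exact hts.trans_le (hg hr hs hrs.le)

theorem le_of_levelRadius_lt (hB : BddAbove {r | 0 < r ∧ t < g r})
    {r : ℝ} (hr : 0 < r) (h : levelRadius g t < r) : g r ≤ t := by
  by_contra! hlt
  exact absurd (le_csSup hB ⟨hr, hlt⟩) (not_le.2 h)

end LevelRadius

/-! ### Growth at the origin from the energy bound -/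

/-- A shell of any small width `ε` around the jump sphere costs a multiple of `ε^(1-p)`, unbounded
as `ε → 0`. This keeps consecutive level radii distinct below. -/
theorem nonlocalEnergy_eq_top_of_jump {N : ℕ} (hN : N ≠ 0) {p δ : ℝ} (hp : 1 < p) (hδ : 0 < δ)
    {f : EuclideanSpace ℝ (Fin N) → ℝ} {t : ℝ} (ht : 0 < t)
    (hjump : ∀ x y, x ≠ 0 → ‖x‖ < t → t < ‖y‖ → f y + δ < f x) :
    nonlocalEnergy p δ f = ∞ := by
  by_contra hne
  have hc := shellConst_pos N p
  have hlim : Tendsto (fun ε : ℝ => shellConst N p * δ ^ p * ((t / 2) ^ (N - 1) * ε ^ (1 - p)))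
      (𝓝[>] 0) atTop := by
    refine Tendsto.const_mul_atTop (by positivity) (Tendsto.const_mul_atTop (by positivity) ?_)
    have := tendsto_rpow_neg_nhdsGT_zero (y := 1 - p) (by linarith)
    exact this
  have hev : ∀ᶠ ε : ℝ in 𝓝[>] 0, 0 < ε ∧ ε < t / 2 :=
    Ioo_mem_nhdsGT (half_pos ht)
  obtain ⟨ε, h1, h2, h3⟩ := ((hlim.eventually_gt_atTop
    (nonlocalEnergy p δ f).toReal).and hev).exists
  have := sum_shells_le_nonlocalEnergy hN (zero_lt_one.trans hp) hδ (f := f) ({0} : Finset ℕ)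
    (fun _ => t - ε / 2) (fun _ => t + ε / 2)
    (by intros; linarith) (by intros; linarith)
    (by simp)
    (fun i _ x y hx h h' => hjump x y hx (by linarith) (by linarith))
  rw [Finset.sum_singleton, ENNReal.ofReal_le_iff_le_toReal hne] at this
  refine absurd (h1.trans_le (le_trans ?_ this)) (lt_irrefl _)
  have e : t + ε / 2 - (t - ε / 2) = ε := by ring
  rw [e]
  gcongr
  linarith

theorem radialProfile_half_le {N : ℕ} (hN : N ≠ 0) {p δ A R : ℝ} (hp : 1 < p) (hδ : 0 < δ)
    (hR : 0 < R) {f : EuclideanSpace ℝ (Fin N) → ℝ} (hf : IsRadiallyDecreasing f)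
    (hA : nonlocalEnergy p δ f ≤ ENNReal.ofReal A) (hA0 : 0 ≤ A) :
    radialProfile f (R / 2) ≤ radialProfile f R + δ +
      (A / shellConst N p) ^ (1 / p) * (R / 2) ^ (-((N - p) / p)) := by
  set g := radialProfile f with hgdef
  have hg : AntitoneOn g (Set.Ioi 0) := hf.antitoneOn_radialProfile hN
  have hc := shellConst_pos N p
  have hp0 : 0 < p := by linarith
  have hR2 : 0 < R / 2 := by positivity
  have hK : 0 ≤ (A / shellConst N p) ^ (1 / p) * (R / 2) ^ (-((N - p) / p)) := by positivity
  rcases le_or_gt (g (R / 2)) (g R + δ) with hle | hlt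
  · linarith
  set h : ℝ := g (R / 2) - g R with hh
  have hhδ : 1 < h / δ := by rw [lt_div_iff₀ hδ]; linarith
  -- The largest integer with `m δ < h` strictly, so that the top level stays below `g (R / 2)`. The
  -- remainder `h - m δ ≤ δ` is the term `δ` of the conclusion.
  set m : ℕ := ⌈h / δ⌉₊ - 1 with hm
  have hceil : 1 < ⌈h / δ⌉₊ := Nat.lt_ceil.2 (by exact_mod_cast hhδ)
  have hm1 : 1 ≤ m := by omega
  have hmcast : (m : ℝ) + 1 = ⌈h / δ⌉₊ := by
    have : m + 1 = ⌈h / δ⌉₊ := by omega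
    exact_mod_cast this
  have hmlt : (m : ℝ) * δ < h := by
    rw [← lt_div_iff₀ hδ]
    have := Nat.ceil_lt_add_one (a := h / δ) (by linarith)
    linarith
  have hmge : h ≤ (m + 1) * δ := by
    rw [← div_le_iff₀ hδ, hmcast]
    exact Nat.le_ceil _
  set lam : ℕ → ℝ := fun i => g R + i * δ with hlam
  set t : ℕ → ℝ := fun i => levelRadius g (lam i) with ht
  have hlamlt : ∀ i ≤ m, lam i < g (R / 2) := by
    intro i hi
    have : (i : ℝ) * δ ≤ m * δ := by gcongr
    simp only [hlam]; linarith
  have hlamge : ∀ i, g R ≤ lam i := fun i => by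
    have : 0 ≤ (i : ℝ) * δ := by positivity
    simp only [hlam]; linarith
  have htm : ∀ i ≤ m, BddAbove {r | 0 < r ∧ lam i < g r} ∧ R / 2 ≤ t i ∧ t i ≤ R := fun i hi =>
    levelRadius_mem hg hR2 hR (hlamlt i hi) (hlamge i)
  have hjump : ∀ i < m, ∀ x y : EuclideanSpace ℝ (Fin N), x ≠ 0 → ‖x‖ < t (i + 1) → t i < ‖y‖ →
      f y + δ < f x := by
    intro i hi x y hx hxt hyt
    have hx0 : 0 < ‖x‖ := norm_pos_iff.2 hx
    have hy0 : 0 < ‖y‖ := lt_trans (by linarith [(htm i hi.le).2.1]) hyt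
    have h1 : lam (i + 1) < g ‖x‖ :=
      lt_of_lt_levelRadius hg hR2 (hlamlt _ hi) hx0 hxt
    have h2 : g ‖y‖ ≤ lam i := le_of_levelRadius_lt (htm i hi.le).1 hy0 hyt
    rw [hf.eq_radialProfile hN hx, hf.eq_radialProfile hN (norm_pos_iff.1 hy0)]
    have h3 : lam (i + 1) = lam i + δ := by simp only [hlam]; push_cast; ring
    rw [h3] at h1
    show g ‖y‖ + δ < g ‖x‖
    linarith
  have hanti : ∀ i < m, t (i + 1) ≤ t i := by
    intro i hi
    refine csSup_le_csSup (htm i hi.le).1 ⟨R / 2, hR2, hlamlt _ hi⟩ ?_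
    rintro r ⟨hr, hr'⟩
    refine ⟨hr, lt_of_le_of_lt ?_ hr'⟩
    simp only [hlam]; push_cast; linarith
  have hanti' : ∀ i j, i ≤ j → j ≤ m → t j ≤ t i := by
    intro i j hij
    induction j, hij using Nat.le_induction with
    | base => intro _; exact le_rfl
    | succ k _ ih => intro hk; exact (hanti k (by omega)).trans (ih (by omega))
  have hstrict : ∀ i < m, t (i + 1) < t i := by
    intro i hi
    -- Equal radii would make `f` drop by more than `δ` across a single sphere.
    refine lt_of_le_of_ne (hanti i hi) fun heq => ?_
    have := nonlocalEnergy_eq_top_of_jump hN hp hδ (f := f) (t := t i)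
      (hR2.trans_le (htm i hi.le).2.1)
      (fun x y hx hxt hyt => hjump i hi x y hx (heq ▸ hxt) hyt)
    rw [this] at hA
    exact absurd hA (by simp)
  have henergy := sum_shells_le_nonlocalEnergy hN hp0 hδ (f := f) (Finset.range m)
    (fun i => t (i + 1)) t (fun i hi => hstrict i (Finset.mem_range.1 hi))
    (fun i hi => by
      have h1 := htm i (Finset.mem_range.1 hi).le
      have h2 := htm (i + 1) (Finset.mem_range.1 hi)
      linarith [h1.2.2, h2.2.1])
    (fun i _ j hj hij => hanti' _ _ hij (Finset.mem_range.1 hj).le)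
    (fun i hi => hjump i (Finset.mem_range.1 hi))
  have hreal := (ENNReal.ofReal_le_ofReal_iff hA0).1 (henergy.trans hA)
  have hsum : ∑ i ∈ Finset.range m, (t i - t (i + 1)) ≤ R / 2 := by
    rw [Finset.sum_range_sub']
    linarith [(htm 0 (by omega)).2.2, (htm m le_rfl).2.1]
  have hjensen := mul_div_rpow_le_sum_rpow (Finset.range m) (fun i => t i - t (i + 1)) hp
    (fun i hi => sub_pos.2 (hstrict i (Finset.mem_range.1 hi)))
    ⟨0, Finset.mem_range.2 hm1⟩ hR2 hsum
  rw [Finset.card_range] at hjensen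
  have hm0 : (0 : ℝ) < m := by exact_mod_cast hm1
  have hlow : shellConst N p * ((m * δ) ^ p * (R / 2) ^ ((N : ℝ) - p)) ≤ A := by
    refine le_trans ?_ hreal
    -- Here `m (R/2/m)^(1-p) = m^p (R/2)^(1-p)`, which turns `δ^p` into `(mδ)^p`.
    calc _ = shellConst N p * δ ^ p * ((R / 2) ^ (N - 1) * (m * (R / 2 / m) ^ (1 - p))) := by
          have e1 : (R / 2) ^ ((N : ℝ) - p) = (R / 2) ^ (N - 1) * (R / 2) ^ (1 - p) := by
            rw [← Real.rpow_natCast, ← Real.rpow_add hR2, Nat.cast_sub (Nat.one_le_iff_ne_zero.2 hN)]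
            congr 1; push_cast; ring
          rw [Real.mul_rpow hm0.le hδ.le, e1, Real.div_rpow hR2.le hm0.le,
            Real.rpow_sub hm0, Real.rpow_one]
          field_simp
      _ ≤ shellConst N p * δ ^ p * ((R / 2) ^ (N - 1) *
            ∑ i ∈ Finset.range m, (t i - t (i + 1)) ^ (1 - p)) := by gcongr
      _ ≤ _ := by
          rw [Finset.mul_sum]
          gcongr with i hi
          · exact Real.rpow_nonneg (sub_nonneg.2 (hanti i (Finset.mem_range.1 hi))) _
          · exact (htm (i + 1) (Finset.mem_range.1 hi)).2.1
  have hfin : m * δ ≤ (A / shellConst N p) ^ (1 / p) * (R / 2) ^ (-((N - p) / p)) := by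
    have h1 : (m * δ) ^ p ≤ A / shellConst N p * (R / 2) ^ (-((N : ℝ) - p)) := by
      rw [Real.rpow_neg hR2.le, ← div_eq_mul_inv, le_div_iff₀ (by positivity), le_div_iff₀ hc]
      linarith
    have h2 := Real.rpow_le_rpow (by positivity) h1 (z := 1 / p) (by positivity)
    rw [← Real.rpow_mul (by positivity), mul_one_div_cancel hp0.ne', Real.rpow_one,
      Real.mul_rpow (by positivity) (by positivity), ← Real.rpow_mul hR2.le] at h2
    refine h2.trans_eq ?_
    congr 2
    ring
  linarith

/-- The decay rate `‖x‖ ^ (-(N - p) / p)` near the origin for radially decreasing functions of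
bounded energy. -/
theorem radialProfile_le_rpow {N : ℕ} (hN : N ≠ 0) {p A B : ℝ} (hp : 1 < p) (hpN : p < N)
    (hA0 : 0 ≤ A) (hB : 0 ≤ B) : ∃ D : ℝ, 0 ≤ D ∧
    ∀ δ : ℝ, 0 < δ → δ ≤ 1 → ∀ f : EuclideanSpace ℝ (Fin N) → ℝ, IsRadiallyDecreasing f →
      nonlocalEnergy p δ f ≤ ENNReal.ofReal A → radialProfile f 1 ≤ B →
      ∀ r : ℝ, 0 < r → r ≤ 1 → radialProfile f r ≤ D * r ^ (-((N - p) / p)) := by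
  set s : ℝ := (N - p) / p with hs
  have hs0 : 0 < s := div_pos (by linarith) (by linarith)
  set K : ℝ := (A / shellConst N p) ^ (1 / p) with hK
  have hc := shellConst_pos N p
  have hK0 : 0 ≤ K := by positivity
  set b : ℝ := 2 ^ s with hb
  have hb1 : 1 < b := Real.one_lt_rpow (by norm_num) hs0
  -- Halving the radius multiplies `r^(-s)` by `b`. `D` is chosen with `D ≥ B` to start the dyadic
  -- induction and `D + 1 + K b ≤ D b` to close it, the `1` absorbing `δ`. Non-dyadic radii cost a
  -- further factor `b`.
  set D : ℝ := B + (1 + K * b) / (b - 1) with hD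
  have hD0 : 0 ≤ D := by
    have : 0 < b - 1 := by linarith
    positivity
  have hDb : D + 1 + K * b ≤ D * b := by
    have h1 : (1 + K * b) / (b - 1) * (b - 1) = 1 + K * b := div_mul_cancel₀ _ (by linarith)
    have h2 : 0 ≤ B * (b - 1) := mul_nonneg hB (by linarith)
    have : D * (b - 1) = B * (b - 1) + (1 + K * b) := by rw [hD, add_mul, h1]
    linarith
  have hpow : ∀ k : ℕ, (((1 : ℝ) / 2) ^ k) ^ (-s) = b ^ k := fun k => by
    rw [Real.rpow_neg (by positivity), ← Real.rpow_natCast, ← Real.rpow_mul (by norm_num),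
      one_div, Real.inv_rpow (by norm_num), inv_inv, mul_comm, Real.rpow_mul (by norm_num),
      Real.rpow_natCast]
  refine ⟨D * b, by positivity, fun δ hδ hδ1 f hf hA hB1 => ?_⟩
  have hdyadic : ∀ k : ℕ, radialProfile f ((1 / 2) ^ k) ≤ D * b ^ k := by
    intro k
    induction k with
    | zero =>
      have : 0 ≤ (1 + K * b) / (b - 1) := div_nonneg (by positivity) (by linarith)
      simp only [pow_zero, mul_one]; linarith
    | succ k ih =>
      have h := radialProfile_half_le hN hp hδ (R := (1 / 2) ^ k) (by positivity) hf hA hA0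
      have e1 : ((1 : ℝ) / 2) ^ k / 2 = (1 / 2) ^ (k + 1) := by rw [pow_succ]; ring
      rw [e1, hpow] at h
      have hbk : 1 ≤ b ^ k := one_le_pow₀ hb1.le
      calc _ ≤ _ := h
        _ ≤ D * b ^ k + 1 * b ^ k + K * b ^ (k + 1) := by gcongr; linarith
        _ = (D + 1 + K * b) * b ^ k := by ring
        _ ≤ (D * b) * b ^ k := by gcongr
        _ = _ := by ring
  intro r hr hr1
  obtain ⟨k, hk1, hk2⟩ := exists_nat_pow_near_of_lt_one hr hr1 (y := (1 / 2 : ℝ))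
    (by norm_num) (by norm_num)
  calc radialProfile f r ≤ radialProfile f ((1 / 2) ^ (k + 1)) :=
        hf.antitoneOn_radialProfile hN (Set.mem_Ioi.2 (by positivity)) hr hk1.le
    _ ≤ D * b ^ (k + 1) := hdyadic _
    _ = D * b * (((1 : ℝ) / 2) ^ k) ^ (-s) := by
        rw [hpow, pow_succ]; ring
    _ ≤ D * b * r ^ (-s) := by
        gcongr ?_ * ?_
        exact Real.rpow_le_rpow_of_nonpos hr hk2 (by linarith)

/-! ### Decay at infinity from the `L^p` bound -/

/-- Chebyshev. Besides the decay, it bounds the set defining the rearrangement at `x ≠ 0`, whose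
`sSup` would otherwise be the default `0`, spoiling monotonicity. -/
theorem le_of_ball_lt_distributionFunction {N : ℕ} (hN : N ≠ 0) {p : ℝ} (hp : 0 < p)
    {u : EuclideanSpace ℝ (Fin N) → ℝ} {C : ℝ≥0} (hu : MemLp u (ENNReal.ofReal p) volume)
    (hC : eLpNorm u (ENNReal.ofReal p) volume ≤ C) {x : EuclideanSpace ℝ (Fin N)} (hx : x ≠ 0)
    {t : ℝ} (ht : 0 ≤ t) (h : volume (Metric.ball (0 : EuclideanSpace ℝ (Fin N)) ‖x‖) <
      distributionFunction u t) :
    t ≤ ((C : ℝ) ^ p / volume.real (Metric.ball (0 : EuclideanSpace ℝ (Fin N)) 1)) ^ (1 / p) *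
      ‖x‖ ^ (-(N / p)) := by
  have hω0 := volume_real_unitBall_pos N
  set ω := volume.real (Metric.ball (0 : EuclideanSpace ℝ (Fin N)) 1)
  have hx0 : 0 < ‖x‖ := norm_pos_iff.2 hx
  have h1 := mul_meas_ge_le_pow_eLpNorm' volume (p := ENNReal.ofReal p) (by simpa using hp)
    ENNReal.ofReal_ne_top hu.aestronglyMeasurable (ENNReal.ofReal t)
  rw [ENNReal.toReal_ofReal hp.le] at h1
  have h2 : distributionFunction u t ≤ volume {x | ENNReal.ofReal t ≤ ‖u x‖ₑ} := by
    refine measure_mono fun y hy => ?_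
    have hy' : t < |u y| := hy
    show ENNReal.ofReal t ≤ ‖u y‖ₑ
    rw [← ofReal_norm]
    exact ENNReal.ofReal_le_ofReal hy'.le
  have h3 : ENNReal.ofReal (t ^ p * (‖x‖ ^ N * ω)) ≤ ENNReal.ofReal ((C : ℝ) ^ p) := by
    rw [ENNReal.ofReal_mul (by positivity), ← volume_ball_eq hN 0 (norm_nonneg x),
      ← ENNReal.ofReal_rpow_of_nonneg ht hp.le,
      ← ENNReal.ofReal_rpow_of_nonneg C.coe_nonneg hp.le]
    calc _ ≤ ENNReal.ofReal t ^ p * volume {x | ENNReal.ofReal t ≤ ‖u x‖ₑ} := by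
          exact mul_le_mul_right (h.le.trans h2) _
      _ ≤ _ := h1
      _ ≤ (C : ℝ≥0∞) ^ p := by gcongr
      _ = _ := by simp
  rw [ENNReal.ofReal_le_ofReal_iff (by positivity)] at h3
  have h4 : t ^ p ≤ (C : ℝ) ^ p / ω * ‖x‖ ^ (-(N : ℝ)) := by
    rw [Real.rpow_neg hx0.le, ← div_eq_mul_inv, le_div_iff₀ (by positivity), le_div_iff₀ hω0,
      Real.rpow_natCast]
    linarith
  have h5 := Real.rpow_le_rpow (by positivity) h4 (z := 1 / p) (by positivity)
  rw [← Real.rpow_mul ht, mul_one_div_cancel hp.ne', Real.rpow_one,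
    Real.mul_rpow (by positivity) (by positivity), ← Real.rpow_mul hx0.le] at h5
  refine h5.trans_eq ?_
  congr 2
  ring

theorem schwarzRearrangement_nonneg {N : ℕ} (u : EuclideanSpace ℝ (Fin N) → ℝ)
    (x : EuclideanSpace ℝ (Fin N)) : 0 ≤ schwarzRearrangement u x :=
  Real.sSup_nonneg fun _ ht => ht.1

theorem schwarzRearrangement_le {N : ℕ} (hN : N ≠ 0) {p : ℝ} (hp : 0 < p)
    {u : EuclideanSpace ℝ (Fin N) → ℝ} {C : ℝ≥0} (hu : MemLp u (ENNReal.ofReal p) volume)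
    (hC : eLpNorm u (ENNReal.ofReal p) volume ≤ C) {x : EuclideanSpace ℝ (Fin N)} (hx : x ≠ 0) :
    schwarzRearrangement u x ≤
      ((C : ℝ) ^ p / volume.real (Metric.ball (0 : EuclideanSpace ℝ (Fin N)) 1)) ^ (1 / p) *
        ‖x‖ ^ (-(N / p)) :=
  Real.sSup_le (fun _ ht => le_of_ball_lt_distributionFunction hN hp hu hC hx ht.1 ht.2)
    (by positivity)

theorem isRadiallyDecreasing_schwarzRearrangement {N : ℕ} (hN : N ≠ 0) {p : ℝ} (hp : 0 < p)
    {u : EuclideanSpace ℝ (Fin N) → ℝ} {C : ℝ≥0} (hu : MemLp u (ENNReal.ofReal p) volume)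
    (hC : eLpNorm u (ENNReal.ofReal p) volume ≤ C) :
    IsRadiallyDecreasing (schwarzRearrangement u) := by
  intro x y hx hxy
  refine Real.sSup_le (fun t ht => ?_) (schwarzRearrangement_nonneg u x)
  refine le_csSup ⟨_, fun s hs => le_of_ball_lt_distributionFunction hN hp hu hC hx hs.1 hs.2⟩ ?_
  exact ⟨ht.1, (measure_mono (Metric.ball_subset_ball hxy)).trans_lt ht.2⟩

/-! ### Compactness and the integrable envelope -/

/-- Helly's selection principle for antitone functions on the half-line. -/
theorem exists_subseq_tendsto_of_antitoneOn {g : ℕ → ℝ → ℝ}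
    (hg : ∀ n, AntitoneOn (g n) (Set.Ioi 0)) {M : ℝ → ℝ}
    (hM : ∀ n r, 0 < r → |g n r| ≤ M r) :
    ∃ ψ : ℕ → ℕ, StrictMono ψ ∧ ∃ w : ℝ → ℝ, AntitoneOn w (Set.Ioi 0) ∧
      ∃ S : Set ℝ, S.Countable ∧
        ∀ r, 0 < r → r ∉ S → Tendsto (fun n => g (ψ n) r) atTop (𝓝 (w r)) := by
  let Q := {q : ℚ // 0 < q}
  have hQ : ∀ q : Q, (0 : ℝ) < (q.1 : ℝ) := fun q => by exact_mod_cast q.2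
  have hcomp : IsCompact (Set.pi Set.univ fun q : Q => Set.Icc (-M q.1) (M q.1)) :=
    isCompact_univ_pi fun _ => isCompact_Icc
  -- Sequential compactness of a countable product of intervals replaces the diagonal argument over
  -- positive rationals.
  obtain ⟨l, -, ψ, hψ, hl⟩ := hcomp.isSeqCompact (x := fun n (q : Q) => g n q.1)
    (fun n q _ => abs_le.1 (hM n q.1 (hQ q)))
  rw [tendsto_pi_nhds] at hl
  have hanti : ∀ a b : Q, a.1 ≤ b.1 → l b ≤ l a := fun a b hab =>
    le_of_tendsto_of_tendsto' (hl b) (hl a) fun n =>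
      hg _ (hQ a) (hQ b) (by exact_mod_cast hab)
  have hrat : ∀ a b : ℝ, 0 ≤ a → a < b → ∃ q : Q, a < q.1 ∧ (q.1 : ℝ) < b := by
    intro a b ha hab
    obtain ⟨q, hq1, hq2⟩ := exists_rat_btwn hab
    exact ⟨⟨q, by exact_mod_cast ha.trans_lt hq1⟩, hq1, hq2⟩
  -- The right limit of `l`. The bounds `w q ≤ l q ≤ w a` for `a < q` squeeze the sequence at
  -- continuity points of `w`, and an antitone `w` has only countably many discontinuities.
  set w : ℝ → ℝ := fun r => sSup (l '' {q : Q | r < (q.1 : ℝ)}) with hw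
  have hbdd : ∀ r : ℝ, 0 < r → BddAbove (l '' {q : Q | r < (q.1 : ℝ)}) := by
    intro r hr
    obtain ⟨q, hq1, hq2⟩ := hrat 0 r le_rfl hr
    refine ⟨l q, ?_⟩
    rintro _ ⟨q', hq', rfl⟩
    have : (q.1 : ℝ) < q'.1 := hq2.trans hq'
    exact hanti _ _ (by exact_mod_cast this.le)
  have hne : ∀ r : ℝ, 0 < r → (l '' {q : Q | r < (q.1 : ℝ)}).Nonempty := by
    intro r hr
    obtain ⟨q, hq1, -⟩ := hrat r (r + 1) hr.le (by linarith)
    exact ⟨l q, q, hq1, rfl⟩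
  have hwanti : AntitoneOn w (Set.Ioi 0) := by
    intro a ha b hb hab
    refine csSup_le_csSup (hbdd a ha) (hne b hb) (Set.image_mono fun q hq => ?_)
    exact lt_of_le_of_lt hab hq
  have hle : ∀ (a : ℝ) (q : Q), 0 < a → a < q.1 → l q ≤ w a := fun a q ha hq =>
    le_csSup (hbdd a ha) ⟨q, hq, rfl⟩
  have hge : ∀ q : Q, w q.1 ≤ l q := by
    intro q
    refine csSup_le (hne _ (hQ q)) ?_
    rintro _ ⟨q', hq', rfl⟩
    have : (q.1 : ℝ) < q'.1 := hq'
    exact hanti _ _ (by exact_mod_cast this.le)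
  refine ⟨ψ, hψ, w, hwanti, _, hwanti.countable_not_continuousWithinAt, fun r hr hrS => ?_⟩
  have hcont : ContinuousAt w r := by
    have : ContinuousWithinAt w (Set.Ioi 0) r := by
      by_contra h
      exact hrS ⟨hr, h⟩
    exact this.continuousAt (Ioi_mem_nhds hr)
  refine tendsto_order.2 ⟨fun a ha => ?_, fun a ha => ?_⟩
  · obtain ⟨b, hb, hb'⟩ := (((hcont.eventually_const_lt ha).filter_mono nhdsWithin_le_nhds).and
      (self_mem_nhdsWithin (s := Set.Ioi r))).exists
    obtain ⟨q, hq1, hq2⟩ := hrat r b hr.le hb'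
    have hlt : a < l q := hb.trans_le ((hwanti (hQ q) (hr.trans hb') hq2.le).trans (hge q))
    filter_upwards [(hl q).eventually_const_lt hlt] with n hn
    exact lt_of_lt_of_le hn (hg _ hr (hQ q) hq1.le)
  · have hev : ∀ᶠ b in 𝓝[<] r, 0 < b ∧ b < r := Ioo_mem_nhdsLT hr
    obtain ⟨b, hb, hb0, hb'⟩ :=
      (((hcont.eventually_lt_const ha).filter_mono nhdsWithin_le_nhds).and hev).exists
    obtain ⟨q, hq1, hq2⟩ := hrat b r hb0.le hb'
    have hlt : l q < a := (hle b q hb0 hq1).trans_lt hb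
    filter_upwards [(hl q).eventually_lt_const hlt] with n hn
    exact lt_of_le_of_lt (hg _ (hQ q) hr hq2.le) hn

/-- Dominated convergence in `L^q`. -/
theorem tendsto_eLpNorm_sub_of_dominated {α : Type*} {m : MeasurableSpace α} {μ : Measure α}
    {q : ℝ≥0∞} (hq0 : q ≠ 0) (hq : q ≠ ∞) {F : ℕ → α → ℝ} {f G : α → ℝ}
    (hF : ∀ n, AEStronglyMeasurable (F n) μ) (hf : AEStronglyMeasurable f μ) (hG : MemLp G q μ)
    (hFG : ∀ n, ∀ᵐ x ∂μ, ‖F n x‖ ≤ G x) (hfG : ∀ᵐ x ∂μ, ‖f x‖ ≤ G x)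
    (hlim : ∀ᵐ x ∂μ, Tendsto (fun n => F n x) atTop (𝓝 (f x))) :
    Tendsto (fun n => eLpNorm (fun x => F n x - f x) q μ) atTop (𝓝 0) := by
  have hq' : 0 < q.toReal := ENNReal.toReal_pos hq0 hq
  have h : Tendsto (fun n => ∫⁻ x, ‖F n x - f x‖ₑ ^ q.toReal ∂μ) atTop (𝓝 (∫⁻ _, 0 ∂μ)) := by
    refine tendsto_lintegral_of_dominated_convergence' (fun x => ‖(2 * G x : ℝ)‖ₑ ^ q.toReal)
      (fun n => ((hF n).sub hf).enorm.pow_const _) ?_ ?_ ?_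
    · intro n
      filter_upwards [hFG n, hfG] with x h1 h2
      gcongr
      rw [enorm_le_iff_norm_le]
      calc ‖F n x - f x‖ ≤ ‖F n x‖ + ‖f x‖ := norm_sub_le _ _
        _ ≤ 2 * G x := by linarith
        _ ≤ ‖2 * G x‖ := Real.le_norm_self _
    · exact (lintegral_rpow_enorm_lt_top_of_eLpNorm_lt_top hq0 hq (hG.const_mul 2).2).ne
    · filter_upwards [hlim] with x hx
      have h1 : Tendsto (fun n => ‖F n x - f x‖ₑ) atTop (𝓝 0) := by
        have := (hx.sub_const (f x)).enorm
        simpa using this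
      have := (ENNReal.continuous_rpow_const (y := q.toReal)).continuousAt.tendsto.comp h1
      simpa [Function.comp_def, ENNReal.zero_rpow_of_pos hq'] using this
  have h2 := (ENNReal.continuous_rpow_const (y := 1 / q.toReal)).continuousAt.tendsto.comp h
  simp only [eLpNorm_eq_lintegral_rpow_enorm_toReal hq0 hq]
  simpa [Function.comp_def, ENNReal.zero_rpow_of_pos (inv_pos.2 hq')] using h2

/-- The radial function equal to `D ρ ^ (-a)` for `ρ < 1` and to `C ρ ^ (-b)` for `ρ ≥ 1`. -/
noncomputable def powerEnvelope (D C a b : ℝ) (ρ : ℝ) : ℝ :=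
  if ρ < 1 then D * ρ ^ (-a) else C * ρ ^ (-b)

/-- In polar coordinates the integrands are `y^(N-1-ar)` near `0` and `y^(N-1-br)` near infinity. -/
theorem memLp_powerEnvelope {N : ℕ} (hN : N ≠ 0) {D C a b r : ℝ} (hD : 0 ≤ D) (hC : 0 ≤ C)
    (hr : 0 < r) (ha : a * r < N) (hb : N < b * r) :
    MemLp (fun x : EuclideanSpace ℝ (Fin N) => powerEnvelope D C a b ‖x‖)
      (ENNReal.ofReal r) volume := by
  have : Nonempty (Fin N) := ⟨⟨0, Nat.pos_of_ne_zero hN⟩⟩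
  have hmeas : Measurable (powerEnvelope D C a b) :=
    Measurable.ite measurableSet_Iio (by fun_prop) (by fun_prop)
  have hexp : ∀ y : ℝ, 0 < y → ∀ c : ℝ, y ^ (N - 1) * (y ^ (-c)) ^ r = y ^ ((N : ℝ) - 1 - c * r) := by
    intro y hy c
    rw [← Real.rpow_natCast, ← Real.rpow_mul hy.le, ← Real.rpow_add hy,
      Nat.cast_sub (Nat.one_le_iff_ne_zero.2 hN)]
    congr 1; push_cast; ring
  have hmeas' : Measurable fun x : EuclideanSpace ℝ (Fin N) => powerEnvelope D C a b ‖x‖ :=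
    hmeas.comp measurable_norm
  rw [← integrable_norm_rpow_iff hmeas'.aestronglyMeasurable
    (by simpa using hr) ENNReal.ofReal_ne_top, ENNReal.toReal_ofReal hr.le,
    integrable_fun_norm_addHaar volume (f := fun y => ‖powerEnvelope D C a b y‖ ^ r),
    finrank_euclideanSpace_fin, ← Set.Ioo_union_Ici_eq_Ioi zero_lt_one]
  refine IntegrableOn.union ?_ ?_
  · have h : IntegrableOn (fun y : ℝ => D ^ r * y ^ ((N : ℝ) - 1 - a * r)) (Set.Ioo 0 1) :=
      ((intervalIntegral.integrableOn_Ioo_rpow_iff zero_lt_one).2 (by linarith)).const_mul _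
    refine h.congr_fun (fun y hy => ?_) measurableSet_Ioo
    have hy0 : 0 < y := hy.1
    have e : powerEnvelope D C a b y = D * y ^ (-a) := if_pos hy.2
    simp only [smul_eq_mul]
    rw [e, Real.norm_of_nonneg (by positivity), Real.mul_rpow hD (by positivity), ← hexp y hy0]
    ring
  · have h : IntegrableOn (fun y : ℝ => C ^ r * y ^ ((N : ℝ) - 1 - b * r)) (Set.Ici 1) := by
      rw [integrableOn_Ici_iff_integrableOn_Ioi]
      exact (integrableOn_Ioi_rpow_of_lt (by linarith) zero_lt_one).const_mul _
    refine h.congr_fun (fun y hy => ?_) measurableSet_Ici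
    have hy0 : 0 < y := lt_of_lt_of_le zero_lt_one hy
    have e : powerEnvelope D C a b y = C * y ^ (-b) := if_neg (not_lt.2 hy)
    simp only [smul_eq_mul]
    rw [e, Real.norm_of_nonneg (by positivity), Real.mul_rpow hC (by positivity), ← hexp y hy0]
    ring

theorem ae_norm_notMem_of_countable {N : ℕ} (hN : N ≠ 0) {S : Set ℝ} (hS : S.Countable) :
    ∀ᵐ x : EuclideanSpace ℝ (Fin N), ‖x‖ ∉ S := by
  have : Nonempty (Fin N) := ⟨⟨0, Nat.pos_of_ne_zero hN⟩⟩
  have h : (volume : Measure (EuclideanSpace ℝ (Fin N))) (⋃ r ∈ S, Metric.sphere 0 r) = 0 :=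
    (measure_biUnion_null_iff hS).2 fun r _ => Measure.addHaar_sphere _ _ _
  refine measure_mono_null (fun x hx => ?_) h
  have hx' : ‖x‖ ∈ S := by simpa using hx
  simpa using hx'

/-! ### Conclusion -/

theorem mainTheorem4 (N : ℕ) (p : ℝ) (hp : 1 < p) (hpN : p < N)
    (u : ℕ → EuclideanSpace ℝ (Fin N) → ℝ)
    (hu_nonneg : ∀ n, 0 ≤ᵐ[volume] u n)
    (hu_mem : ∀ n, MemLp (u n) (ENNReal.ofReal p) volume)
    (hu_bdd : ∃ C : ℝ≥0, ∀ n, eLpNorm (u n) (ENNReal.ofReal p) volume ≤ C)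
    (δ : ℕ → ℝ) (hδ : Tendsto δ atTop (𝓝[>] 0))
    (hI : liminf (fun n => nonlocalEnergy p (δ n) (schwarzRearrangement (u n))) atTop < ∞) :
    ∃ φ : ℕ → ℕ, StrictMono φ ∧
      ∃ v : EuclideanSpace ℝ (Fin N) → ℝ, IsRadiallyDecreasing v ∧
        ∀ r : ℝ, p < r → r < N * p / (N - p) →
          (∀ n, MemLp (schwarzRearrangement (u (φ n))) (ENNReal.ofReal r) volume) ∧
          MemLp v (ENNReal.ofReal r) volume ∧
          Tendsto (fun n =>
            eLpNorm (fun x => schwarzRearrangement (u (φ n)) x - v x) (ENNReal.ofReal r) volume)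
            atTop (𝓝 0) := by
  have hp0 : 0 < p := by linarith
  have hN : N ≠ 0 := by
    rintro rfl
    norm_num at hpN
    linarith
  obtain ⟨C, hC⟩ := hu_bdd
  have hrad : ∀ n, IsRadiallyDecreasing (schwarzRearrangement (u n)) := fun n =>
    isRadiallyDecreasing_schwarzRearrangement hN hp0 (hu_mem n) (hC n)
  obtain ⟨A, hA, -⟩ := ENNReal.lt_iff_exists_nnreal_btwn.1 hI
  have hδ' : ∀ᶠ n in atTop, 0 < δ n ∧ δ n < 1 := hδ (Ioo_mem_nhdsGT zero_lt_one)
  -- A finite liminf bounds the energy by `A` only for infinitely many indices, hence a first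
  -- extraction, which also secures `0 < δ n < 1`.
  obtain ⟨φ₀, hφ₀, hP⟩ := extraction_of_frequently_atTop
    ((frequently_lt_of_liminf_lt (by isBoundedDefault) hA).and_eventually hδ')
  set B : ℝ :=
    ((C : ℝ) ^ p / volume.real (Metric.ball (0 : EuclideanSpace ℝ (Fin N)) 1)) ^ (1 / p) with hB
  have hB0 : 0 ≤ B := by positivity
  have hfar : ∀ n x, x ≠ 0 → schwarzRearrangement (u n) x ≤ B * ‖x‖ ^ (-(N / p)) :=
    fun n x hx => schwarzRearrangement_le hN hp0 (hu_mem n) (hC n) hx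
  have hone : ∀ n, radialProfile (schwarzRearrangement (u n)) 1 ≤ B := by
    intro n
    obtain ⟨x, hx⟩ := EuclideanSpace.exists_norm_eq hN zero_le_one
    have hx0 : x ≠ 0 := norm_pos_iff.1 (by rw [hx]; exact one_pos)
    have := hfar n x hx0
    rw [(hrad n).eq_radialProfile hN hx0, hx] at this
    simpa using this
  obtain ⟨D, hD0, hD⟩ := radialProfile_le_rpow hN hp hpN A.2 hB0
  set H : ℝ → ℝ := powerEnvelope D B ((N - p) / p) (N / p) with hH
  have hbound : ∀ n x, x ≠ 0 → ‖schwarzRearrangement (u (φ₀ n)) x‖ ≤ H ‖x‖ := by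
    intro n x hx
    rw [Real.norm_of_nonneg (schwarzRearrangement_nonneg _ _), hH, powerEnvelope]
    split_ifs with h
    · rw [(hrad _).eq_radialProfile hN hx]
      exact hD _ (hP n).2.1 (hP n).2.2.le _ (hrad _) (by simpa using (hP n).1.le) (hone _) _
        (norm_pos_iff.2 hx) h.le
    · exact hfar _ x hx
  obtain ⟨ψ, hψ, w, hw, S, hS, hlim⟩ := exists_subseq_tendsto_of_antitoneOn
    (g := fun n => radialProfile (schwarzRearrangement (u (φ₀ n)))) (M := H)
    (fun n => (hrad _).antitoneOn_radialProfile hN) (by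
      intro n r hr
      obtain ⟨x, rfl⟩ := EuclideanSpace.exists_norm_eq hN hr.le
      have hx := norm_pos_iff.1 hr
      rw [← (hrad _).eq_radialProfile hN hx]
      exact hbound n x hx)
  have hv : IsRadiallyDecreasing fun x : EuclideanSpace ℝ (Fin N) => w ‖x‖ := by
    intro x y hx hxy
    have hx0 : 0 < ‖x‖ := norm_pos_iff.2 hx
    exact hw hx0 (hx0.trans_le hxy) hxy
  have hne : ∀ᵐ x : EuclideanSpace ℝ (Fin N), x ≠ 0 := by
    filter_upwards [ae_norm_notMem_of_countable hN (Set.countable_singleton 0)] with x hx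
    simpa using hx
  have hconv : ∀ᵐ x : EuclideanSpace ℝ (Fin N),
      Tendsto (fun n => schwarzRearrangement (u (φ₀ (ψ n))) x) atTop (𝓝 (w ‖x‖)) := by
    filter_upwards [ae_norm_notMem_of_countable hN hS, hne] with x hxS hx
    refine (hlim _ (norm_pos_iff.2 hx) hxS).congr fun n => ?_
    exact ((hrad _).eq_radialProfile hN hx).symm
  have hbound' : ∀ n, ∀ᵐ x : EuclideanSpace ℝ (Fin N),
      ‖schwarzRearrangement (u (φ₀ (ψ n))) x‖ ≤ H ‖x‖ := fun n => by
    filter_upwards [hne] with x hx using hbound _ x hx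
  have hboundv : ∀ᵐ x : EuclideanSpace ℝ (Fin N), ‖w ‖x‖‖ ≤ H ‖x‖ := by
    filter_upwards [hconv, hne] with x hx hx0
    exact le_of_tendsto' hx.norm fun n => hbound _ x hx0
  -- The subsequence, the limit and the envelope `H` are fixed before `r`, so they serve every
  -- exponent at once.
  refine ⟨φ₀ ∘ ψ, hφ₀.comp hψ, fun x => w ‖x‖, hv, fun r hpr hr => ?_⟩
  have hr0 : 0 < r := hp0.trans hpr
  have hNp : (0 : ℝ) < N - p := by linarith
  have hHr : MemLp (fun x : EuclideanSpace ℝ (Fin N) => H ‖x‖) (ENNReal.ofReal r) volume := by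
    refine memLp_powerEnvelope hN hD0 hB0 hr0 ?_ ?_
    · rw [lt_div_iff₀ hNp] at hr
      rw [div_mul_eq_mul_div, div_lt_iff₀ hp0]
      linarith
    · rw [div_mul_eq_mul_div, lt_div_iff₀ hp0]
      have : (0 : ℝ) < N := by linarith
      gcongr
  have hmeas : ∀ n, AEStronglyMeasurable (schwarzRearrangement (u n)) volume := fun n =>
    ((hrad n).measurable hN).aestronglyMeasurable
  have hmeasv : AEStronglyMeasurable (fun x : EuclideanSpace ℝ (Fin N) => w ‖x‖) volume :=
    (hv.measurable hN).aestronglyMeasurable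
  exact ⟨fun n => hHr.mono' (hmeas _) (hbound' n), hHr.mono' hmeasv hboundv,
    tendsto_eLpNorm_sub_of_dominated (by simpa using hr0) ENNReal.ofReal_ne_top
      (fun n => hmeas _) hmeasv hHr hbound' hboundv hconv⟩
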